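/- **Setting.** A topological nonautonomous dynamical system $(X_\infty,f_\infty)$ consists of compact metric spaces $(X_n,d_n)$, $n\ge 0$, and maps $f_n:X_n\to X_{n+1}$ that are equicontinuous: for every $\varepsilon>0$ there is $\delta>0$ such that $d_n(x,y)<\delta$ implies $d_{n+1}(f_n(x),f_n(y))<\varepsilon$ for all $n\ge 0$ and $x,y\in X_n$. Put $f_0^0=\mathrm{id}$, $f_0^i=f_{i-1}\circ\dots\circ f_0$. An invariant measure sequence (IMS) is a sequence $\mu_\infty=(\mu_n)_{n\ge 0}$ of Borel probability measures on the spaces $X_n$ whose push-forwards satisfy $f_n\mu_n=\mu_{n+1}$ for all $n$. A sequence $\mathcal P_\infty=(\mathcal P_n)_{n\ge0}$ of finite Borel partitions $\mathcal P_n=\{P_{n,1},\dots,P_{n,k_n}\}$ of $X_n$ is admissible, written $\mathcal P_\infty\in\mathcal E(\mu_\infty)$, if $(k_n)$ is bounded and for every $\varepsilon>0$ there are $\delta>0$ and compact sets $K_{n,i}\subset P_{n,i}$ such that, for all $n$, $\mu_n(P_{n,i}\setminus K_{n,i})\le\varepsilon$ for every $i$, and $d_n(x,y)\ge\delta$ for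 all $x\in K_{n,i}$, $y\in K_{n,j}$, $i\ne j$. The metric entropy is $$h(f_\infty,\mu_\infty)=\sup_{\mathcal P_\infty\in\mathcal E(\mu_\infty)}\ \limsup_{n\to\infty}\frac1n H_{\mu_0}\Big(\bigvee_{i=0}^{n-1}(f_0^i)^{-1}\mathcal P_i\Big)\in[0,\infty],\qquad H_{\mu}(\mathcal P)=-\sum_{P\in\mathcal P}\mu(P)\log\mu(P).$$ The IMS $\mu_\infty$ is called fine-scale if there are $\mathcal P^l_\infty\in\mathcal E(\mu_\infty)$, $l\ge0$, with $\sup_{n}\sup_{P\in\mathcal P^l_n}\operatorname{diam}P\to0$ as $l\to\infty$. The direct product of two systems consists of the spaces $X_n\times Y_n$ with the maximum metrics, the maps $f_n\times g_n$ and the product measures $\mu_n\times\nu_n$. **Proposition 3.13.** Let $(X_\infty,f_\infty)$ and $(Y_\infty,g_\infty)$ be topological nonautonomous dynamical systems with fine-scale IMS $\mu_\infty$ and $\nu_\infty$, respectively. Under each of the following three conditions, $$h(f_\infty\times g_\infty,\mu_\infty\times\nu_\infty)=h(f_\infty,\mu_\infty)+h(g_\infty,\nu_\infty).$$ (a) One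 of the factors has zero entropy. In this case the entropy of the product equals the entropy of the other factor; e.g. if $h(g_\infty,\nu_\infty)=0$, then $h(f_\infty\times g_\infty,\mu_\infty\times\nu_\infty)=h(f_\infty,\mu_\infty)$. (b) One of the systems is autonomous, say $(Y_n,g_n,\nu_n)=(Y,g,\nu)$ for all $n$. In this case $$h(f_\infty\times g_\infty,\mu_\infty\times\nu_\infty)=h(f_\infty,\mu_\infty)+h_\nu(g),$$ where $h_\nu(g)$ is the Kolmogorov–Sinai entropy of $g$ with respect to $\nu$; likewise with the roles of the two factors exchanged. (c) $(X_\infty,f_\infty)=(Y_\infty,g_\infty)$ and $\mu_\infty=\nu_\infty$. In this case $$h(f_\infty\times f_\infty,\mu_\infty\times\mu_\infty)=2\,h(f_\infty,\mu_\infty).$$ -/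

import Mathlib

open MeasureTheory Filter Topology Set

universe u v

namespace NDS

/-- A measurable partition of `X`, written as a family of pairwise disjoint measurable sets which is
indexed by `ι` and covers `X`. Some members of the family may be empty. -/
structure MeasPartition (ι : Type*) (X : Type*) [MeasurableSpace X] where
  /-- The members of the partition. -/
  part : ι → Set X
  measurableSet_part : ∀ i, MeasurableSet (part i)
  disjoint_part : ∀ i j, i ≠ j → Disjoint (part i) (part j)
  iUnion_part : ⋃ i, part i = univ

/-- The Shannon entropy `-∑ μ(A i) log μ(A i)` of a finite family of sets
(used for the members of a finite partition). -/
noncomputable def shannonEntropy {X ι : Type*} [MeasurableSpace X] [Fintype ι]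
    (μ : Measure X) (A : ι → Set X) : ℝ :=
  ∑ i, Real.negMulLog (μ.real (A i))

section Autonomous

variable {Y : Type*} [MeasurableSpace Y]

/-- The members of the join of `g⁻⁰ Q, …, g⁻⁽ⁿ⁻¹⁾ Q`, indexed by the itineraries. -/
def ksJoin (g : Y → Y) {k : ℕ} (Q : MeasPartition (Fin k) Y) (n : ℕ) (a : Fin n → Fin k) : Set Y :=
  ⋂ i : Fin n, g^[i] ⁻¹' Q.part (a i)

/-- The Kolmogorov–Sinai entropy of `g` with respect to `ν`: the supremum over all finite measurable
partitions `Q` of the exponential growth rate of the entropies of the joins. -/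
noncomputable def ksEntropy (g : Y → Y) (ν : Measure Y) : EReal :=
  ⨆ (k : ℕ) (Q : MeasPartition (Fin k) Y),
    limsup (fun n : ℕ => ((1 / (n : ℝ) * shannonEntropy ν (ksJoin g Q n) : ℝ) : EReal)) atTop

end Autonomous

section Nonautonomous

variable {X : ℕ → Type*}

/-- The composition `f (n-1) ∘ ⋯ ∘ f 0 : X 0 → X n`. -/
def iter (f : ∀ n, X n → X (n + 1)) : ∀ n, X 0 → X n
  | 0 => id
  | n + 1 => f n ∘ iter f n

/-- The sequence `f` is (uniformly) equicontinuous. On compact metric spaces `X n` this says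
that `(X, f)` is a topological nonautonomous dynamical system. -/
def IsTopologicalNDS [∀ n, MetricSpace (X n)] (f : ∀ n, X n → X (n + 1)) : Prop :=
  ∀ ε > (0 : ℝ), ∃ δ > (0 : ℝ), ∀ (n : ℕ) (x y : X n),
    dist x y < δ → dist (f n x) (f n y) < ε

/-- `μ` is an invariant measure sequence for `f`: a sequence of probability measures,
each of which is pushed forward to the next one. -/
def IsIMS [∀ n, MeasurableSpace (X n)] (f : ∀ n, X n → X (n + 1))
    (μ : ∀ n, Measure (X n)) : Prop :=
  (∀ n, IsProbabilityMeasure (μ n)) ∧ ∀ n, (μ n).map (f n) = μ (n + 1)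

section Partitions

variable [∀ n, MeasurableSpace (X n)]

/-- The members of the join of the pullbacks of `P 0, …, P (n-1)` to `X 0`,
indexed by the itineraries. -/
def join (f : ∀ n, X n → X (n + 1)) {k : ℕ → ℕ} (P : ∀ n, MeasPartition (Fin (k n)) (X n))
    (n : ℕ) (a : ∀ i : Fin n, Fin (k i)) : Set (X 0) :=
  ⋂ i : Fin n, iter f i ⁻¹' (P i).part (a i)

/-- The entropy of `f` with respect to a given sequence of finite partitions. -/
noncomputable def entropyAt (f : ∀ n, X n → X (n + 1)) (μ : ∀ n, Measure (X n)) {k : ℕ → ℕ}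
    (P : ∀ n, MeasPartition (Fin (k n)) (X n)) : EReal :=
  limsup (fun n : ℕ => ((1 / (n : ℝ) * shannonEntropy (μ 0) (join f P n) : ℝ) : EReal)) atTop

variable [∀ n, MetricSpace (X n)]

/-- Admissible sequences of partitions: the cardinalities are bounded, and, up to measure `ε`,
the members of each partition can be replaced by compact subsets whose mutual distances are
bounded from below by some `δ > 0` which does not depend on `n`. -/
def Admissible (μ : ∀ n, Measure (X n)) {k : ℕ → ℕ}
    (P : ∀ n, MeasPartition (Fin (k n)) (X n)) : Prop :=
  (∃ m, ∀ n, k n ≤ m) ∧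
  ∀ ε > (0 : ℝ), ∃ δ > (0 : ℝ), ∃ K : ∀ n, Fin (k n) → Set (X n),
    (∀ n i, IsCompact (K n i) ∧ K n i ⊆ (P n).part i) ∧
    ∀ n, (∀ i, (μ n).real ((P n).part i \ K n i) ≤ ε) ∧
      ∀ i j, i < j → ∀ x ∈ K n i, ∀ y ∈ K n j, δ ≤ dist x y

/-- The metric entropy of `f` with respect to `μ`: the supremum over all admissible sequences. -/
noncomputable def metricEntropy (f : ∀ n, X n → X (n + 1)) (μ : ∀ n, Measure (X n)) : EReal :=
  ⨆ (k : ℕ → ℕ) (P : ∀ n, MeasPartition (Fin (k n)) (X n)) (_ : Admissible μ P), entropyAt f μ P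

/-- The supremum of the diameters of all members of all partitions in the sequence. -/
noncomputable def seqDiam {k : ℕ → ℕ} (P : ∀ n, MeasPartition (Fin (k n)) (X n)) : ENNReal :=
  ⨆ (n : ℕ) (i : Fin (k n)), Metric.ediam ((P n).part i)

/-- `μ` is a fine-scale invariant measure sequence: there are admissible sequences `P 0, P 1, …`
whose diameters tend to zero. -/
def IsFineScaleIMS (f : ∀ n, X n → X (n + 1)) (μ : ∀ n, Measure (X n)) : Prop :=
  IsIMS f μ ∧
  ∃ (k : ℕ → ℕ → ℕ) (P : ∀ l n, MeasPartition (Fin (k l n)) (X n)),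
    (∀ l, Admissible μ (P l)) ∧ Tendsto (fun l => seqDiam (P l)) atTop (𝓝 0)

end Partitions

variable {Y : ℕ → Type*}

/-- The maps of the direct product of two systems. The spaces `X n × Y n` carry the maximum
metric, which is Mathlib's metric on a product. -/
def prodMaps (f : ∀ n, X n → X (n + 1)) (g : ∀ n, Y n → Y (n + 1)) (n : ℕ) :
    X n × Y n → X (n + 1) × Y (n + 1) :=
  Prod.map (f n) (g n)

/-- The metric entropy of the direct product of two systems with respect to the sequence of
product measures. -/
noncomputable def prodEntropy [∀ n, MeasurableSpace (X n)] [∀ n, MetricSpace (X n)]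
    [∀ n, MeasurableSpace (Y n)] [∀ n, MetricSpace (Y n)]
    (f : ∀ n, X n → X (n + 1)) (μ : ∀ n, Measure (X n))
    (g : ∀ n, Y n → Y (n + 1)) (ν : ∀ n, Measure (Y n)) : EReal :=
  metricEntropy (X := fun n => X n × Y n) (prodMaps f g) (fun n => (μ n).prod (ν n))

end Nonautonomous

end NDS

/-! Write `a n` and `b n` for the normalised entropies of the joins of two partition sequences, one
per factor. For product partitions and product measures, entropy is exactly additive at every `n`
(`shannonEntropy_join_prodSeq`), so the product sequence has growth rate `limsup (a + b)`.

Fine scales make such product sequences sufficient. A cell of small diameter meets at most one of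
the uniformly separated compact cores of an admissible sequence, so its position predicts the
admissible cell up to small measure. A Fano estimate (`shannonEntropy_join_le`) turns this into an
arbitrarily small entropy loss per time step (`Admissible.exists_entropyAt_le`). Products of
fine-scale sequences are again admissible and fine, hence they compute the entropy of the product,
and the inequality `≤` always holds.

By `prodEntropy_eq_add`, only `limsup a + limsup b ≤ limsup (a + b)` along fine-scale sequences
remains, and each condition supplies it. With zero entropy, one summand is nonnegative with `limsup`
at most zero. With an autonomous factor, constant partition sequences suffice, and subadditivity
makes that summand converge. With equal factors, the two summands coincide. -/

namespace NDS

/-! ### Entropy inequalities for finite families of weights. -/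

section Entropy

/-- Gibbs' inequality for non-negative weights on a finite set. -/
theorem sum_negMulLog_le {α : Type*} [Fintype α] {p q : α → ℝ} (hp : ∀ a, 0 ≤ p a)
    (hq : ∀ a, p a ≠ 0 → 0 < q a) (hq0 : ∀ a, 0 ≤ q a) (hpq : ∑ a, q a ≤ ∑ a, p a) :
    ∑ a, Real.negMulLog (p a) ≤ ∑ a, p a * -Real.log (q a) := by
  -- This is `log t ≤ t - 1` at `t = q a / p a`; the corrections `q a - p a` have nonpositive sum by
  -- `hpq`.
  have key : ∀ a, Real.negMulLog (p a) ≤ p a * -Real.log (q a) + (q a - p a) := by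
    intro a
    by_cases h : p a = 0
    · simp [h, hq0 a]
    · have hpa : 0 < p a := lt_of_le_of_ne (hp a) (Ne.symm h)
      have hlog := Real.log_le_sub_one_of_pos (div_pos (hq a h) hpa)
      rw [Real.log_div (hq a h).ne' h] at hlog
      have h2 := mul_le_mul_of_nonneg_left hlog hpa.le
      have h3 : p a * (q a / p a - 1) = q a - p a := by field_simp
      rw [h3] at h2
      simp only [Real.negMulLog]
      linarith
  calc ∑ a, Real.negMulLog (p a) ≤ ∑ a, (p a * -Real.log (q a) + (q a - p a)) :=
        Finset.sum_le_sum fun a _ => key a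
    _ ≤ _ := by
        rw [Finset.sum_add_distrib, Finset.sum_sub_distrib]
        linarith

theorem sum_negMulLog_marginal_le {α β : Type*} [Fintype α] [Fintype β] {p : α → β → ℝ}
    (hp : ∀ a b, 0 ≤ p a b) :
    ∑ a, Real.negMulLog (∑ b, p a b) ≤ ∑ a, ∑ b, Real.negMulLog (p a b) := by
  refine Finset.sum_le_sum fun a _ => ?_
  simp only [Real.negMulLog]
  conv_lhs => rw [← Finset.sum_neg_distrib, Finset.sum_mul]
  refine Finset.sum_le_sum fun b _ => ?_
  by_cases h : p a b = 0
  · simp [h]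
  · have hpa : 0 < p a b := lt_of_le_of_ne (hp a b) (Ne.symm h)
    have := Real.log_le_log hpa (Finset.single_le_sum (fun b _ => hp a b) (Finset.mem_univ b))
    nlinarith

/-- Here `c` is a guess for the conditional law of `a` given `b`. The left side is at most the joint
entropy, and Gibbs' inequality against (marginal of `b`) times `c` bounds the joint entropy. -/
theorem sum_negMulLog_le_of_kernel {α β : Type*} [Fintype α] [Fintype β] {p c : α → β → ℝ}
    (hp : ∀ a b, 0 ≤ p a b) (hc : ∀ a b, 0 < c a b) (hc1 : ∀ b, ∑ a, c a b ≤ 1) :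
    ∑ a, Real.negMulLog (∑ b, p a b) ≤ ∑ b, Real.negMulLog (∑ a, p a b) +
      ∑ a, ∑ b, p a b * -Real.log (c a b) := by
  refine (sum_negMulLog_marginal_le hp).trans ?_
  have hle : ∀ a b, p a b ≤ ∑ a, p a b := fun a b =>
    Finset.single_le_sum (f := fun a => p a b) (fun a _ => hp a b) (Finset.mem_univ a)
  have hr : ∀ b, 0 ≤ ∑ a, p a b := fun b => Finset.sum_nonneg fun a _ => hp a b
  have h := sum_negMulLog_le (p := fun x : α × β => p x.1 x.2)
    (q := fun x : α × β => (∑ a, p a x.2) * c x.1 x.2) (fun x => hp _ _)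
    (fun x hx => mul_pos (lt_of_lt_of_le (lt_of_le_of_ne (hp _ _) (Ne.symm hx)) (hle _ _))
      (hc _ _)) (fun x => mul_nonneg (hr _) (hc _ _).le) (by
        rw [Fintype.sum_prod_type_right, Fintype.sum_prod_type_right]
        refine Finset.sum_le_sum fun b _ => ?_
        simp only
        rw [← Finset.mul_sum]
        exact mul_le_of_le_one_right (hr b) (hc1 b))
  rw [Fintype.sum_prod_type] at h
  refine h.trans (le_of_eq ?_)
  have h1 : ∀ b, Real.negMulLog (∑ a, p a b) = ∑ a, p a b * -Real.log (∑ a, p a b) := by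
    intro b
    rw [← Finset.sum_mul, Real.negMulLog]
    ring
  simp_rw [h1]
  rw [Finset.sum_comm (s := (Finset.univ : Finset β)), Fintype.sum_prod_type,
    ← Finset.sum_add_distrib]
  refine Finset.sum_congr rfl fun a _ => ?_
  rw [← Finset.sum_add_distrib]
  refine Finset.sum_congr rfl fun b _ => ?_
  by_cases h0 : p a b = 0
  · simp [h0]
  · have : 0 < ∑ a, p a b := lt_of_lt_of_le (lt_of_le_of_ne (hp _ _) (Ne.symm h0)) (hle a b)
    simp only
    rw [Real.log_mul this.ne' (hc a b).ne']
    ring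

/-- Gibbs' inequality against the product of the two marginals. -/
theorem sum_negMulLog_le_add {α β : Type*} [Fintype α] [Fintype β] {p : α → β → ℝ}
    (hp : ∀ a b, 0 ≤ p a b) (hp1 : ∑ a, ∑ b, p a b = 1) :
    ∑ a, ∑ b, Real.negMulLog (p a b) ≤
      ∑ a, Real.negMulLog (∑ b, p a b) + ∑ b, Real.negMulLog (∑ a, p a b) := by
  have hleA : ∀ a b, p a b ≤ ∑ b, p a b := fun a b =>
    Finset.single_le_sum (f := fun b => p a b) (fun b _ => hp a b) (Finset.mem_univ b)
  have hleB : ∀ a b, p a b ≤ ∑ a, p a b := fun a b =>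
    Finset.single_le_sum (f := fun a => p a b) (fun a _ => hp a b) (Finset.mem_univ a)
  have hpos : ∀ a b, p a b ≠ 0 → 0 < p a b := fun a b h => lt_of_le_of_ne (hp _ _) (Ne.symm h)
  have h := sum_negMulLog_le (p := fun x : α × β => p x.1 x.2)
    (q := fun x : α × β => (∑ b, p x.1 b) * (∑ a, p a x.2)) (fun x => hp _ _)
    (fun x hx => mul_pos ((hpos _ _ hx).trans_le (hleA _ _)) ((hpos _ _ hx).trans_le (hleB _ _)))
    (fun x => mul_nonneg (Finset.sum_nonneg fun _ _ => hp _ _)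
      (Finset.sum_nonneg fun _ _ => hp _ _)) (by
        rw [Fintype.sum_prod_type, Fintype.sum_prod_type]
        simp only
        rw [← Finset.sum_mul_sum, hp1, Finset.sum_comm, hp1, one_mul])
  rw [Fintype.sum_prod_type] at h
  refine h.trans (le_of_eq ?_)
  have hA : ∀ a, Real.negMulLog (∑ b, p a b) = ∑ b, p a b * -Real.log (∑ b, p a b) := by
    intro a
    rw [← Finset.sum_mul, Real.negMulLog]
    ring
  have hB : ∀ b, Real.negMulLog (∑ a, p a b) = ∑ a, p a b * -Real.log (∑ a, p a b) := by
    intro b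
    rw [← Finset.sum_mul, Real.negMulLog]
    ring
  simp_rw [hA, hB]
  rw [Finset.sum_comm (s := (Finset.univ : Finset β)), Fintype.sum_prod_type,
    ← Finset.sum_add_distrib]
  refine Finset.sum_congr rfl fun a _ => ?_
  rw [← Finset.sum_add_distrib]
  refine Finset.sum_congr rfl fun b _ => ?_
  by_cases h0 : p a b = 0
  · simp [h0]
  · simp only
    rw [Real.log_mul ((hpos _ _ h0).trans_le (hleA _ _)).ne'
      ((hpos _ _ h0).trans_le (hleB _ _)).ne']
    ring

end Entropy

/-! ### Shannon entropy of measurable partitions and their products. -/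

section MeasPartition

variable {X ι κ : Type*} [MeasurableSpace X]

theorem MeasPartition.exists_mem_part (P : MeasPartition ι X) (x : X) : ∃ i, x ∈ P.part i :=
  mem_iUnion.1 (P.iUnion_part ▸ mem_univ x)

theorem MeasPartition.eq_of_mem (P : MeasPartition ι X) {x : X} {i j : ι} (hi : x ∈ P.part i)
    (hj : x ∈ P.part j) : i = j := by
  by_contra h
  exact disjoint_left.1 (P.disjoint_part i j h) hi hj

theorem MeasPartition.sum_measureReal_inter [Fintype ι] (P : MeasPartition ι X) (μ : Measure X)
    [IsFiniteMeasure μ] {s : Set X} (hs : MeasurableSet s) :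
    ∑ i, μ.real (s ∩ P.part i) = μ.real s := by
  rw [← measureReal_iUnion_fintype, ← inter_iUnion, P.iUnion_part, inter_univ]
  · intro i j hij
    exact (P.disjoint_part i j hij).mono inter_subset_right inter_subset_right
  · exact fun i => hs.inter (P.measurableSet_part i)

theorem MeasPartition.sum_measureReal [Fintype ι] (P : MeasPartition ι X) (μ : Measure X)
    [IsProbabilityMeasure μ] : ∑ i, μ.real (P.part i) = 1 := by
  simpa using P.sum_measureReal_inter μ MeasurableSet.univ

theorem shannonEntropy_nonneg [Fintype ι] (μ : Measure X) [IsProbabilityMeasure μ]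
    (A : ι → Set X) : 0 ≤ shannonEntropy μ A :=
  Finset.sum_nonneg fun _ _ => Real.negMulLog_nonneg measureReal_nonneg measureReal_le_one

theorem shannonEntropy_le_of_kernel [Fintype ι] [Fintype κ] (μ : Measure X) [IsFiniteMeasure μ]
    (Q : MeasPartition ι X) (P : MeasPartition κ X) {c : ι → κ → ℝ} (hc : ∀ a b, 0 < c a b)
    (hc1 : ∀ b, ∑ a, c a b ≤ 1) :
    shannonEntropy μ Q.part ≤ shannonEntropy μ P.part +
      ∑ a, ∑ b, μ.real (Q.part a ∩ P.part b) * -Real.log (c a b) := by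
  have h := sum_negMulLog_le_of_kernel (p := fun a b => μ.real (Q.part a ∩ P.part b))
    (fun _ _ => measureReal_nonneg) hc hc1
  have h2 : ∀ b, ∑ a, μ.real (Q.part a ∩ P.part b) = μ.real (P.part b) := fun b => by
    simp_rw [inter_comm _ (P.part b)]
    exact Q.sum_measureReal_inter μ (P.measurableSet_part b)
  simp only [h2, fun a => P.sum_measureReal_inter μ (Q.measurableSet_part a)] at h
  exact h

theorem shannonEntropy_inter_le [Fintype ι] [Fintype κ] (μ : Measure X) [IsProbabilityMeasure μ]
    (Q : MeasPartition ι X) (P : MeasPartition κ X) :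
    shannonEntropy μ (fun x : ι × κ => Q.part x.1 ∩ P.part x.2) ≤
      shannonEntropy μ Q.part + shannonEntropy μ P.part := by
  have hA := fun a => P.sum_measureReal_inter μ (Q.measurableSet_part a)
  have hB : ∀ b, ∑ a, μ.real (Q.part a ∩ P.part b) = μ.real (P.part b) := fun b => by
    simp_rw [inter_comm _ (P.part b)]
    exact Q.sum_measureReal_inter μ (P.measurableSet_part b)
  have h := sum_negMulLog_le_add (p := fun a b => μ.real (Q.part a ∩ P.part b))
    (fun _ _ => measureReal_nonneg) (by simp only [hA, Q.sum_measureReal])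
  simp only [hA, hB] at h
  rw [shannonEntropy, Fintype.sum_prod_type]
  exact h

theorem shannonEntropy_comp_equiv [Fintype ι] [Fintype κ] (μ : Measure X) (A : ι → Set X)
    (e : κ ≃ ι) : shannonEntropy μ (fun i => A (e i)) = shannonEntropy μ A :=
  Equiv.sum_comp e fun i => Real.negMulLog (μ.real (A i))

/-- The product of two partitions. -/
def MeasPartition.prod {Y : Type*} [MeasurableSpace Y] (P : MeasPartition ι X)
    (Q : MeasPartition κ Y) : MeasPartition (ι × κ) (X × Y) where
  part a := P.part a.1 ×ˢ Q.part a.2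
  measurableSet_part a := (P.measurableSet_part _).prod (Q.measurableSet_part _)
  disjoint_part a b hab := by
    rw [Set.disjoint_prod]
    by_contra! h
    refine hab (Prod.ext ?_ ?_)
    · exact by_contra fun h' => h.1 (P.disjoint_part _ _ h')
    · exact by_contra fun h' => h.2 (Q.disjoint_part _ _ h')
  iUnion_part := by
    ext ⟨x, y⟩
    simpa using ⟨P.exists_mem_part x, Q.exists_mem_part y⟩

/-- Renaming the members of a partition. -/
def MeasPartition.reindex (P : MeasPartition ι X) (e : κ ≃ ι) : MeasPartition κ X where
  part a := P.part (e a)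
  measurableSet_part a := P.measurableSet_part _
  disjoint_part a b hab := P.disjoint_part _ _ (e.injective.ne hab)
  iUnion_part := by rw [e.surjective.iUnion_comp, P.iUnion_part]

theorem shannonEntropy_prod {Y : Type*} [MeasurableSpace Y] [Fintype ι] [Fintype κ]
    (μ : Measure X) (ν : Measure Y) [IsProbabilityMeasure μ] [IsProbabilityMeasure ν]
    (P : MeasPartition ι X) (Q : MeasPartition κ Y) :
    shannonEntropy (μ.prod ν) (P.prod Q).part =
      shannonEntropy μ P.part + shannonEntropy ν Q.part := by
  simp only [shannonEntropy, MeasPartition.prod, measureReal_prod_prod, Real.negMulLog_mul,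
    Fintype.sum_prod_type, Finset.sum_add_distrib, ← Finset.sum_mul, ← Finset.mul_sum,
    P.sum_measureReal, Q.sum_measureReal, one_mul]

end MeasPartition

/-! ### Joins along orbits and the Fano estimate. -/

section Join

variable {X : ℕ → Type*} [∀ n, MeasurableSpace (X n)]

theorem measurable_iter {f : ∀ n, X n → X (n + 1)} (hf : ∀ n, Measurable (f n)) :
    ∀ n, Measurable (iter f n)
  | 0 => measurable_id
  | n + 1 => (hf n).comp (measurable_iter hf n)

theorem IsIMS.measurePreserving_iter {f : ∀ n, X n → X (n + 1)} {μ : ∀ n, Measure (X n)}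
    (hμ : IsIMS f μ) (hf : ∀ n, Measurable (f n)) : ∀ n, MeasurePreserving (iter f n) (μ 0) (μ n)
  | 0 => MeasurePreserving.id _
  | n + 1 => MeasurePreserving.comp ⟨hf n, hμ.2 n⟩ (hμ.measurePreserving_iter hf n)

/-- The join of the pullbacks of `P 0, …, P (n-1)` to `X 0`. -/
def joinPartition {f : ∀ n, X n → X (n + 1)} (hf : ∀ n, Measurable (f n)) {k : ℕ → ℕ}
    (P : ∀ n, MeasPartition (Fin (k n)) (X n)) (n : ℕ) :
    MeasPartition (∀ i : Fin n, Fin (k i)) (X 0) where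
  part := join f P n
  measurableSet_part a := MeasurableSet.iInter fun i =>
    measurable_iter hf i ((P i).measurableSet_part _)
  disjoint_part a b hab := by
    refine disjoint_left.2 fun x hxa hxb => hab ?_
    ext1 i
    exact (P i).eq_of_mem (mem_iInter.1 hxa i) (mem_iInter.1 hxb i)
  iUnion_part := by
    refine eq_univ_of_forall fun x => mem_iUnion.2 ?_
    choose a ha using fun i : Fin n => (P i).exists_mem_part (iter f i x)
    exact ⟨a, mem_iInter.2 ha⟩

/-- A Fano type inequality: the entropies of two joins are close, if the members of one
sequence of partitions are, up to a small measure, unions of members of the other one. -/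
theorem shannonEntropy_join_le {f : ∀ n, X n → X (n + 1)} {μ : ∀ n, Measure (X n)}
    (hμ : IsIMS f μ) (hf : ∀ n, Measurable (f n)) {k m : ℕ → ℕ}
    (Q : ∀ n, MeasPartition (Fin (k n)) (X n)) (P : ∀ n, MeasPartition (Fin (m n)) (X n))
    {M : ℕ} (hM0 : 0 < M) (hM : ∀ n, k n ≤ M) (φ : ∀ n, Fin (m n) → Fin (k n)) {η ε : ℝ}
    (hη : 0 < η) (hη1 : η < 1) (hηM : η ≤ M)
    (hφ : ∀ n, (μ n).real {x | ∃ j l, x ∈ (Q n).part j ∧ x ∈ (P n).part l ∧ j ≠ φ n l} ≤ ε)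
    (n : ℕ) :
    shannonEntropy (μ 0) (join f Q n) ≤ shannonEntropy (μ 0) (join f P n) +
      n * (-Real.log (1 - η) + ε * -Real.log (η / M)) := by
  have := hμ.1
  have hM0' : (0 : ℝ) < M := by exact_mod_cast hM0
  -- One-step prediction of the `Q`-cell from the `P`-cell: nearly all mass sits on `φ`, and every
  -- other cell keeps the positive weight `η / M` so that its logarithmic cost stays finite.
  set c : ∀ i, Fin (k i) → Fin (m i) → ℝ := fun i j l => if j = φ i l then 1 - η else η / M
    with hc
  have hcpos : ∀ i j l, 0 < c i j l := by
    intro i j l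
    simp only [hc]
    split_ifs
    · linarith
    · positivity
  have hcsum : ∀ i l, ∑ j, c i j l ≤ 1 := by
    intro i l
    calc ∑ j, c i j l ≤ ∑ j, ((if j = φ i l then 1 - η else 0) + η / M) := by
          refine Finset.sum_le_sum fun j _ => ?_
          simp only [hc]
          split_ifs
          · have : 0 < η / M := by positivity
            linarith
          · simp
      _ = 1 - η + k i * (η / M) := by
          rw [Finset.sum_add_distrib]
          simp
      _ ≤ 1 - η + M * (η / M) := by
          have : (k i : ℝ) ≤ M := by exact_mod_cast hM i
          gcongr
      _ = 1 := by field_simp; ring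
  -- The kernel on itineraries is the product over times; its logarithm splits into one cost per
  -- time step, which makes the error linear in `n`.
  have h := shannonEntropy_le_of_kernel (μ 0) (joinPartition hf Q n) (joinPartition hf P n)
    (c := fun a b => ∏ i : Fin n, c i (a i) (b i)) (fun a b => Finset.prod_pos fun i _ => hcpos _ _ _)
    (fun b => by
      rw [← Fintype.piFinset_univ, ← Finset.prod_univ_sum _ fun (i : Fin n) j => c i j (b i)]
      exact Finset.prod_le_one (fun i _ => Finset.sum_nonneg fun j _ => (hcpos _ _ _).le)
        fun i _ => hcsum _ _)
  refine h.trans (add_le_add_right ?_ _)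
  set p := fun (a : ∀ i : Fin n, Fin (k i)) (b : ∀ i : Fin n, Fin (m i)) =>
    (μ 0).real (join f Q n a ∩ join f P n b) with hp
  have hL : 0 ≤ -Real.log (η / M) := by
    rw [neg_nonneg]
    exact Real.log_nonpos (by positivity) (by rw [div_le_one hM0']; exact hηM)
  have hL0 : 0 ≤ -Real.log (1 - η) := by
    rw [neg_nonneg]
    exact Real.log_nonpos (by linarith) (by linarith)
  have hpsum : ∑ a, ∑ b, p a b = 1 := by
    simp only [hp]
    have := fun a => (joinPartition hf P n).sum_measureReal_inter (μ 0)
      ((joinPartition hf Q n).measurableSet_part a)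
    exact (Finset.sum_congr rfl fun a _ => this a).trans ((joinPartition hf Q n).sum_measureReal _)
  -- The summed cells are disjoint and lie in the preimage under `iter f i` of the misprediction set
  -- at time `i`; invariance moves the estimate to `μ i`.
  have hbad : ∀ i : Fin n, ∑ a, ∑ b, (if a i = φ i (b i) then 0 else p a b) ≤ ε := by
    intro i
    classical
    refine le_trans ?_ (hφ i)
    have hB : MeasurableSet
        {x | ∃ j l, x ∈ (Q i).part j ∧ x ∈ (P i).part l ∧ j ≠ φ i l} := by
      have : {x | ∃ j l, x ∈ (Q i).part j ∧ x ∈ (P i).part l ∧ j ≠ φ i l} =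
          ⋃ j, ⋃ l, ⋃ _ : j ≠ φ i l, (Q i).part j ∩ (P i).part l := by
        ext x
        simp only [mem_ofPred_eq, mem_iUnion, mem_inter_iff, exists_prop]
        exact exists_congr fun j => exists_congr fun l => by tauto
      rw [this]
      exact MeasurableSet.iUnion fun j => MeasurableSet.iUnion fun l => MeasurableSet.iUnion
        fun _ => ((Q i).measurableSet_part j).inter ((P i).measurableSet_part l)
    rw [← Fintype.sum_prod_type', ← (hμ.measurePreserving_iter hf i).measureReal_preimage
      hB.nullMeasurableSet]
    simp_rw [← ite_not (p := _ = _)]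
    rw [← Finset.sum_filter, ← measureReal_biUnion_finset]
    · refine measureReal_mono ?_
      simp only [iUnion_subset_iff, Finset.mem_filter]
      rintro ⟨a, b⟩ ⟨-, hab⟩ x ⟨hxa, hxb⟩
      exact ⟨a i, b i, mem_iInter.1 hxa i, mem_iInter.1 hxb i, hab⟩
    · rintro ⟨a, b⟩ - ⟨a', b'⟩ - hne
      refine disjoint_left.2 fun x hx hx' => hne (Prod.ext ?_ ?_)
      · exact (joinPartition hf Q n).eq_of_mem hx.1 hx'.1
      · exact (joinPartition hf P n).eq_of_mem hx.2 hx'.2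
    · exact fun x _ => ((joinPartition hf Q n).measurableSet_part _).inter
        ((joinPartition hf P n).measurableSet_part _)
  calc ∑ a, ∑ b, p a b * -Real.log (∏ i : Fin n, c i (a i) (b i))
      ≤ ∑ a, ∑ b, ∑ i, (p a b * -Real.log (1 - η) +
          (if a i = φ i (b i) then 0 else p a b) * -Real.log (η / M)) := by
        refine Finset.sum_le_sum fun a _ => Finset.sum_le_sum fun b _ => ?_
        rw [Real.log_prod fun i _ => (hcpos _ _ _).ne', ← Finset.sum_neg_distrib, Finset.mul_sum]
        refine Finset.sum_le_sum fun i _ => ?_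
        have hpp : 0 ≤ p a b := measureReal_nonneg
        simp only [hc]
        split_ifs
        · simp
        · have := mul_nonneg hpp hL0
          linarith
    _ = ∑ i : Fin n, (-Real.log (1 - η) +
          (∑ a, ∑ b, (if a i = φ i (b i) then 0 else p a b)) * -Real.log (η / M)) := by
        simp_rw [Finset.sum_comm (t := (Finset.univ : Finset (Fin n)))]
        refine Finset.sum_congr rfl fun i _ => ?_
        simp_rw [Finset.sum_add_distrib, ← Finset.sum_mul, hpsum, one_mul]
    _ ≤ ∑ i : Fin n, (-Real.log (1 - η) + ε * -Real.log (η / M)) :=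
        Finset.sum_le_sum fun i _ => by gcongr; exact hbad i
    _ = _ := by rw [Finset.sum_const, Finset.card_univ, Fintype.card_fin, nsmul_eq_mul]

end Join

/-! ### Approximating admissible sequences by sequences of small diameter. -/

section Approximation

theorem le_of_forall_le_add_coe {a b : EReal} (h : ∀ e : ℝ, 0 < e → a ≤ b + e) : a ≤ b := by
  refine EReal.le_of_forall_lt_iff_le.1 fun z hz => ?_
  obtain ⟨w, hbw, hwz⟩ := EReal.lt_iff_exists_real_btwn.1 hz
  have hwz' : w < z := EReal.coe_lt_coe_iff.1 hwz
  calc a ≤ b + ((z - w : ℝ) : EReal) := h _ (sub_pos.2 hwz')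
    _ ≤ w + ((z - w : ℝ) : EReal) := by gcongr
    _ = z := by rw [← EReal.coe_add]; congr 1; ring

theorem IsTopologicalNDS.measurable {X : ℕ → Type*} [∀ n, MetricSpace (X n)]
    [∀ n, MeasurableSpace (X n)] [∀ n, BorelSpace (X n)] {f : ∀ n, X n → X (n + 1)}
    (hf : IsTopologicalNDS f) (n : ℕ) : Measurable (f n) := by
  refine Continuous.measurable (Metric.continuous_iff.2 fun y ε hε => ?_)
  obtain ⟨δ, hδ, h⟩ := hf ε hε
  exact ⟨δ, hδ, fun x hx => h n x y hx⟩

variable {X : ℕ → Type*} [∀ n, MeasurableSpace (X n)]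

theorem entropyAt_nonneg {f : ∀ n, X n → X (n + 1)} {μ : ∀ n, Measure (X n)}
    (hμ : IsIMS f μ) {k : ℕ → ℕ} (P : ∀ n, MeasPartition (Fin (k n)) (X n)) :
    0 ≤ entropyAt f μ P := by
  have := hμ.1
  refine le_limsup_of_frequently_le (Frequently.of_forall fun n => ?_)
  exact EReal.coe_nonneg.2 (mul_nonneg (by positivity) (shannonEntropy_nonneg _ _))

theorem entropyAt_le_add {f : ∀ n, X n → X (n + 1)} {μ : ∀ n, Measure (X n)} {k m : ℕ → ℕ}
    {Q : ∀ n, MeasPartition (Fin (k n)) (X n)} {P : ∀ n, MeasPartition (Fin (m n)) (X n)} {e : ℝ}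
    (h : ∀ n : ℕ, shannonEntropy (μ 0) (join f Q n) ≤ shannonEntropy (μ 0) (join f P n) + n * e)
    (he : 0 ≤ e) : entropyAt f μ Q ≤ entropyAt f μ P + e := by
  have h1 : entropyAt f μ Q ≤ limsup ((fun n : ℕ =>
      ((1 / (n : ℝ) * shannonEntropy (μ 0) (join f P n) : ℝ) : EReal)) + fun _ => (e : EReal))
      atTop := by
    refine limsup_le_limsup (Eventually.of_forall fun n => ?_)
    simp only [Pi.add_apply]
    rw [← EReal.coe_add, EReal.coe_le_coe_iff]
    -- At `n = 0` the factor `1 / n` is zero, and only `0 ≤ e` is needed.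
    rcases Nat.eq_zero_or_pos n with rfl | hn
    · simpa using he
    · have hn' : (0 : ℝ) < n := by exact_mod_cast hn
      calc 1 / (n : ℝ) * shannonEntropy (μ 0) (join f Q n)
          ≤ 1 / (n : ℝ) * (shannonEntropy (μ 0) (join f P n) + n * e) := by gcongr; exact h n
        _ = _ := by field_simp
  refine h1.trans ((EReal.limsup_add_le ?_ ?_).trans ?_)
  · right; simp
  · right; simp
  · rw [limsup_const, entropyAt]

variable [∀ n, MetricSpace (X n)]

/-- Every admissible sequence of partitions is approximated by all sequences of partitions
with sufficiently small diameters. -/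
theorem Admissible.exists_entropyAt_le {f : ∀ n, X n → X (n + 1)} {μ : ∀ n, Measure (X n)}
    (hμ : IsIMS f μ) (hf : ∀ n, Measurable (f n)) {k : ℕ → ℕ}
    {Q : ∀ n, MeasPartition (Fin (k n)) (X n)} (hQ : Admissible μ Q) {e : ℝ} (he : 0 < e) :
    ∃ δ : ENNReal, 0 < δ ∧ ∀ (m : ℕ → ℕ) (P : ∀ n, MeasPartition (Fin (m n)) (X n)),
      seqDiam P < δ → entropyAt f μ Q ≤ entropyAt f μ P + e := by
  have := hμ.1
  have hk : ∀ n, Nonempty (Fin (k n)) := fun n =>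
    have := nonempty_of_isProbabilityMeasure (μ n)
    ⟨((Q n).exists_mem_part this.some).choose⟩
  obtain ⟨⟨M, hM⟩, hQ⟩ := hQ
  have hM0 : 0 < M := (Fin.pos_iff_nonempty.2 (hk 0)).trans_le (hM 0)
  have hM0' : (1 : ℝ) ≤ M := by exact_mod_cast hM0
  obtain ⟨η, hη, hη1, hηe⟩ : ∃ η : ℝ, 0 < η ∧ η < 1 ∧ -Real.log (1 - η) < e / 2 := by
    have hcont : ContinuousAt (fun η : ℝ => -Real.log (1 - η)) 0 := by
      apply ContinuousAt.neg
      apply ContinuousAt.log (by fun_prop) (by simp)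
    have h1 : ∀ᶠ η : ℝ in 𝓝[>] 0, -Real.log (1 - η) < e / 2 :=
      (hcont.eventually_lt continuousAt_const (by simpa using half_pos he)).filter_mono
        nhdsWithin_le_nhds
    obtain ⟨η, h2, h3, h4⟩ := (h1.and (Ioo_mem_nhdsGT (zero_lt_one (α := ℝ)))).exists
    exact ⟨η, h3, h4, h2⟩
  -- `ε` is chosen after `η`, since it must beat the now fixed cost `-log (η / M)`. The factor `M`
  -- accounts for the at most `M` sets `Q_j \ K_j` that can contain a mispredicted point.
  obtain ⟨ε, hε, hεe⟩ : ∃ ε : ℝ, 0 < ε ∧ M * ε * -Real.log (η / M) < e / 2 := by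
    have hcont : ContinuousAt (fun ε : ℝ => M * ε * -Real.log (η / M)) 0 := by fun_prop
    have h1 : ∀ᶠ ε : ℝ in 𝓝[>] 0, M * ε * -Real.log (η / M) < e / 2 :=
      (hcont.eventually_lt continuousAt_const (by simpa using half_pos he)).filter_mono
        nhdsWithin_le_nhds
    obtain ⟨ε, h2, h3⟩ := (h1.and self_mem_nhdsWithin).exists
    exact ⟨ε, h3, h2⟩
  obtain ⟨δ, hδ, K, hK, hKQ⟩ := hQ ε hε
  refine ⟨ENNReal.ofReal δ, by simpa using hδ, fun m P hP => ?_⟩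
  have hsep : ∀ n i j, i ≠ j → ∀ x ∈ K n i, ∀ y ∈ K n j, δ ≤ dist x y := by
    intro n i j hij x hx y hy
    rcases hij.lt_or_gt with h | h
    · exact (hKQ n).2 i j h x hx y hy
    · rw [dist_comm]
      exact (hKQ n).2 j i h y hy x hx
  have huniq : ∀ n (l : Fin (m n)) i j, ((P n).part l ∩ K n i).Nonempty →
      ((P n).part l ∩ K n j).Nonempty → i = j := by
    rintro n l i j ⟨x, hxP, hx⟩ ⟨y, hyP, hy⟩
    by_contra hij
    have h1 : edist x y < ENNReal.ofReal δ := calc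
      edist x y ≤ Metric.ediam ((P n).part l) := Metric.edist_le_ediam_of_mem hxP hyP
      _ ≤ seqDiam P := le_iSup₂_of_le n l le_rfl
      _ < _ := hP
    rw [edist_lt_ofReal] at h1
    exact (hsep n i j hij x hx y hy).not_gt h1
  -- The prediction is the unique core met by the cell, or an arbitrary index if it meets none.
  have hφ : ∀ n (l : Fin (m n)), ∃ j : Fin (k n), ∀ i, ((P n).part l ∩ K n i).Nonempty → i = j := by
    intro n l
    by_cases h : ∃ i, ((P n).part l ∩ K n i).Nonempty
    · obtain ⟨i, hi⟩ := h
      exact ⟨i, fun j hj => huniq n l j i hj hi⟩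
    · exact ⟨(hk n).some, fun i hi => (h ⟨i, hi⟩).elim⟩
  choose φ hφ using hφ
  have hbad : ∀ n, (μ n).real
      {x | ∃ j l, x ∈ (Q n).part j ∧ x ∈ (P n).part l ∧ j ≠ φ n l} ≤ M * ε := by
    intro n
    calc (μ n).real {x | ∃ j l, x ∈ (Q n).part j ∧ x ∈ (P n).part l ∧ j ≠ φ n l}
        ≤ (μ n).real (⋃ j, (Q n).part j \ K n j) := by
          refine measureReal_mono ?_
          rintro x ⟨j, l, hxQ, hxP, hne⟩
          exact mem_iUnion.2 ⟨j, hxQ, fun hxK => hne (hφ n l j ⟨x, hxP, hxK⟩)⟩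
      _ ≤ ∑ j, (μ n).real ((Q n).part j \ K n j) := measureReal_iUnion_fintype_le _
      _ ≤ ∑ j : Fin (k n), ε := Finset.sum_le_sum fun j _ => (hKQ n).1 j
      _ = k n * ε := by simp
      _ ≤ M * ε := by
          have : (k n : ℝ) ≤ M := by exact_mod_cast hM n
          gcongr
  refine entropyAt_le_add (fun n => (shannonEntropy_join_le hμ hf Q P hM0 hM φ hη hη1
    (hη1.le.trans hM0') hbad n).trans ?_) he.le
  gcongr
  linarith

theorem le_metricEntropy (f : ∀ n, X n → X (n + 1)) {μ : ∀ n, Measure (X n)} {k : ℕ → ℕ}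
    {P : ∀ n, MeasPartition (Fin (k n)) (X n)} (hP : Admissible μ P) :
    entropyAt f μ P ≤ metricEntropy f μ :=
  le_iSup₂_of_le k P (le_iSup_of_le hP le_rfl)

theorem exists_lt_entropyAt {f : ∀ n, X n → X (n + 1)} {μ : ∀ n, Measure (X n)} {a : EReal}
    (ha : a < metricEntropy f μ) : ∃ (k : ℕ → ℕ) (P : ∀ n, MeasPartition (Fin (k n)) (X n)),
      Admissible μ P ∧ a < entropyAt f μ P := by
  simp only [metricEntropy, lt_iSup_iff] at ha
  obtain ⟨k, P, hP, h⟩ := ha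
  exact ⟨k, P, hP, h⟩

/-- Refinement in `l` is not assumed, so `entropyAt` need not be monotone in `l`. A bound for all
large `l` lets two factors be handled at one common scale. -/
theorem eventually_lt_entropyAt {f : ∀ n, X n → X (n + 1)} {μ : ∀ n, Measure (X n)}
    (hμ : IsIMS f μ) (hf : ∀ n, Measurable (f n)) {k : ℕ → ℕ → ℕ}
    {P : ∀ l n, MeasPartition (Fin (k l n)) (X n)}
    (hP : Tendsto (fun l => seqDiam (P l)) atTop (𝓝 0)) {a : EReal} (ha : a < metricEntropy f μ) :
    ∀ᶠ l in atTop, a < entropyAt f μ (P l) := by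
  obtain ⟨m, Q, hQ, haQ⟩ := exists_lt_entropyAt ha
  obtain ⟨r, har, hr⟩ := EReal.lt_iff_exists_real_btwn.1 haQ
  obtain ⟨s, hrs, hs⟩ := EReal.lt_iff_exists_real_btwn.1 hr
  have hrs' : r < s := EReal.coe_lt_coe_iff.1 hrs
  obtain ⟨δ, hδ, h⟩ := hQ.exists_entropyAt_le hμ hf (sub_pos.2 hrs')
  filter_upwards [hP.eventually_lt_const hδ] with l hl
  refine har.trans (lt_of_not_ge fun hle => ?_)
  have h1 := hs.trans_le ((h _ _ hl).trans (add_le_add_left hle _))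
  rw [← EReal.coe_add, EReal.coe_lt_coe_iff] at h1
  linarith

end Approximation

/-! ### Products of systems and the reduction to additivity of growth rates. -/

section Product

variable {X Y : ℕ → Type*}

theorem iter_prodMaps (f : ∀ n, X n → X (n + 1)) (g : ∀ n, Y n → Y (n + 1)) (n : ℕ) :
    iter (X := fun n => X n × Y n) (prodMaps f g) n = Prod.map (iter f n) (iter g n) := by
  induction n with
  | zero => rfl
  | succ n ih => simp only [iter, ih, prodMaps, Prod.map_comp_map]

variable [∀ n, MeasurableSpace (X n)] [∀ n, MeasurableSpace (Y n)]

/-- The sequence of the products of the members of two sequences of partitions. -/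
def prodSeq {k m : ℕ → ℕ} (P : ∀ n, MeasPartition (Fin (k n)) (X n))
    (R : ∀ n, MeasPartition (Fin (m n)) (Y n)) (n : ℕ) :
    MeasPartition (Fin (k n * m n)) (X n × Y n) :=
  ((P n).prod (R n)).reindex finProdFinEquiv.symm

theorem prodSeq_part {k m : ℕ → ℕ} (P : ∀ n, MeasPartition (Fin (k n)) (X n))
    (R : ∀ n, MeasPartition (Fin (m n)) (Y n)) (n : ℕ) (a : Fin (k n * m n)) :
    (prodSeq P R n).part a = (P n).part (finProdFinEquiv.symm a).1 ×ˢ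
      (R n).part (finProdFinEquiv.symm a).2 := rfl

theorem IsIMS.prodMaps {f : ∀ n, X n → X (n + 1)} {μ : ∀ n, Measure (X n)}
    {g : ∀ n, Y n → Y (n + 1)} {ν : ∀ n, Measure (Y n)} (hμ : IsIMS f μ) (hν : IsIMS g ν)
    (hf : ∀ n, Measurable (f n)) (hg : ∀ n, Measurable (g n)) :
    IsIMS (X := fun n => X n × Y n) (prodMaps f g) (fun n => (μ n).prod (ν n)) := by
  have := hμ.1
  have := hν.1
  refine ⟨fun n => inferInstance, fun n => ?_⟩
  rw [NDS.prodMaps, ← Measure.map_prod_map _ _ (hf n) (hg n), hμ.2, hν.2]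

/-- The itinerary of a pair is the pair of itineraries, so up to renaming indices the join is the
product of the two joins, and entropy adds over independent partitions. -/
theorem shannonEntropy_join_prodSeq {f : ∀ n, X n → X (n + 1)} {μ : ∀ n, Measure (X n)}
    {g : ∀ n, Y n → Y (n + 1)} {ν : ∀ n, Measure (Y n)} (hμ : IsIMS f μ) (hν : IsIMS g ν)
    (hf : ∀ n, Measurable (f n)) (hg : ∀ n, Measurable (g n)) {k m : ℕ → ℕ}
    (P : ∀ n, MeasPartition (Fin (k n)) (X n)) (R : ∀ n, MeasPartition (Fin (m n)) (Y n))
    (n : ℕ) :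
    shannonEntropy ((μ 0).prod (ν 0))
        (join (X := fun n => X n × Y n) (prodMaps f g) (prodSeq P R) n) =
      shannonEntropy (μ 0) (join f P n) + shannonEntropy (ν 0) (join g R n) := by
  have := hμ.1
  have := hν.1
  let e : (∀ i : Fin n, Fin (k i * m i)) ≃ (∀ i : Fin n, Fin (k i)) × (∀ i : Fin n, Fin (m i)) :=
    (Equiv.piCongrRight fun i : Fin n => (finProdFinEquiv (m := k i) (n := m i)).symm).trans
      (Equiv.arrowProdEquivProdArrow _ _ _)
  refine Eq.trans ?_ ((shannonEntropy_comp_equiv _ _ e).trans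
    (shannonEntropy_prod (μ 0) (ν 0) (joinPartition hf P n) (joinPartition hg R n)))
  congr 1
  funext a
  ext ⟨x, y⟩
  simp only [join, iter_prodMaps, mem_iInter, mem_preimage, prodSeq_part, mem_prod, forall_and,
    MeasPartition.prod, joinPartition]
  rfl

variable [∀ n, MetricSpace (X n)] [∀ n, MetricSpace (Y n)]

theorem seqDiam_prodSeq_le {k m : ℕ → ℕ} (P : ∀ n, MeasPartition (Fin (k n)) (X n))
    (R : ∀ n, MeasPartition (Fin (m n)) (Y n)) :
    seqDiam (X := fun n => X n × Y n) (prodSeq P R) ≤ max (seqDiam P) (seqDiam R) := by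
  refine iSup₂_le fun n i => Metric.ediam_le fun x hx y hy => ?_
  rw [prodSeq_part] at hx hy
  rw [Prod.edist_eq]
  exact max_le_max
    ((Metric.edist_le_ediam_of_mem hx.1 hy.1).trans (le_iSup₂_of_le n _ le_rfl))
    ((Metric.edist_le_ediam_of_mem hx.2 hy.2).trans (le_iSup₂_of_le n _ le_rfl))

/-- Products of cores serve as cores. A point lost from a product cell is lost in one coordinate,
whence `ε / 2` for each factor; distinct index pairs differ in a coordinate, so the maximum metric
separates the cores by `min δ δ'`. -/
theorem Admissible.prodSeq {μ : ∀ n, Measure (X n)} {ν : ∀ n, Measure (Y n)}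
    [∀ n, IsProbabilityMeasure (μ n)] [∀ n, IsProbabilityMeasure (ν n)] {k m : ℕ → ℕ}
    {P : ∀ n, MeasPartition (Fin (k n)) (X n)} {R : ∀ n, MeasPartition (Fin (m n)) (Y n)}
    (hP : Admissible μ P) (hR : Admissible ν R) :
    Admissible (X := fun n => X n × Y n) (fun n => (μ n).prod (ν n)) (prodSeq P R) := by
  obtain ⟨⟨M, hM⟩, hP⟩ := hP
  obtain ⟨⟨N, hN⟩, hR⟩ := hR
  refine ⟨⟨M * N, fun n => Nat.mul_le_mul (hM n) (hN n)⟩, fun ε hε => ?_⟩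
  obtain ⟨δ, hδ, K, hK, hKP⟩ := hP (ε / 2) (half_pos hε)
  obtain ⟨δ', hδ', L, hL, hLR⟩ := hR (ε / 2) (half_pos hε)
  have hK' : ∀ n i j, i ≠ j → ∀ x ∈ K n i, ∀ y ∈ K n j, δ ≤ dist x y := by
    intro n i j hij x hx y hy
    rcases hij.lt_or_gt with h | h
    · exact (hKP n).2 i j h x hx y hy
    · rw [dist_comm]
      exact (hKP n).2 j i h y hy x hx
  have hL' : ∀ n i j, i ≠ j → ∀ x ∈ L n i, ∀ y ∈ L n j, δ' ≤ dist x y := by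
    intro n i j hij x hx y hy
    rcases hij.lt_or_gt with h | h
    · exact (hLR n).2 i j h x hx y hy
    · rw [dist_comm]
      exact (hLR n).2 j i h y hy x hx
  refine ⟨min δ δ', lt_min hδ hδ', fun n a => K n (finProdFinEquiv.symm a).1 ×ˢ
    L n (finProdFinEquiv.symm a).2, fun n a => ⟨(hK n _).1.prod (hL n _).1,
      prod_mono (hK n _).2 (hL n _).2⟩, fun n => ⟨fun a => ?_, fun a b hab => ?_⟩⟩
  · rw [prodSeq_part]
    set i := (finProdFinEquiv.symm a).1
    set j := (finProdFinEquiv.symm a).2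
    calc ((μ n).prod (ν n)).real ((P n).part i ×ˢ (R n).part j \ K n i ×ˢ L n j)
        ≤ ((μ n).prod (ν n)).real
            (((P n).part i \ K n i) ×ˢ univ ∪ univ ×ˢ ((R n).part j \ L n j)) := by
          refine measureReal_mono ?_
          rintro ⟨x, y⟩ ⟨⟨hx, hy⟩, hxy⟩
          by_cases hxK : x ∈ K n i
          · exact Or.inr ⟨mem_univ _, hy, fun hyL => hxy ⟨hxK, hyL⟩⟩
          · exact Or.inl ⟨⟨hx, hxK⟩, mem_univ _⟩
      _ ≤ (μ n).real ((P n).part i \ K n i) + (ν n).real ((R n).part j \ L n j) := by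
          refine (measureReal_union_le _ _).trans_eq ?_
          simp [measureReal_prod_prod]
      _ ≤ ε / 2 + ε / 2 := add_le_add ((hKP n).1 _) ((hLR n).1 _)
      _ = ε := add_halves ε
  · rintro x ⟨hx1, hx2⟩ y ⟨hy1, hy2⟩
    rw [Prod.dist_eq]
    have hne : finProdFinEquiv.symm a ≠ finProdFinEquiv.symm b :=
      finProdFinEquiv.symm.injective.ne hab.ne
    by_cases h : (finProdFinEquiv.symm a).1 = (finProdFinEquiv.symm b).1
    · have h' : (finProdFinEquiv.symm a).2 ≠ (finProdFinEquiv.symm b).2 :=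
        fun h' => hne (Prod.ext h h')
      exact (min_le_right _ _).trans (le_max_of_le_right (hL' n _ _ h' _ hx2 _ hy2))
    · exact (min_le_left _ _).trans (le_max_of_le_left (hK' n _ _ h _ hx1 _ hy1))

/-- The product formula holds if the upper growth rates of the entropies are additive
along a sequence of fine-scale partitions. -/
theorem prodEntropy_eq_add {f : ∀ n, X n → X (n + 1)} {μ : ∀ n, Measure (X n)}
    {g : ∀ n, Y n → Y (n + 1)} {ν : ∀ n, Measure (Y n)} (hμ : IsIMS f μ) (hν : IsIMS g ν)
    (hf : ∀ n, Measurable (f n)) (hg : ∀ n, Measurable (g n)) {k m : ℕ → ℕ → ℕ}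
    {P : ∀ l n, MeasPartition (Fin (k l n)) (X n)} {R : ∀ l n, MeasPartition (Fin (m l n)) (Y n)}
    (hP : ∀ l, Admissible μ (P l)) (hR : ∀ l, Admissible ν (R l))
    (hPd : Tendsto (fun l => seqDiam (P l)) atTop (𝓝 0))
    (hRd : Tendsto (fun l => seqDiam (R l)) atTop (𝓝 0))
    (hadd : ∀ l, entropyAt f μ (P l) + entropyAt g ν (R l) ≤
      limsup ((fun n : ℕ =>
          ((1 / (n : ℝ) * shannonEntropy (μ 0) (join f (P l) n) : ℝ) : EReal)) +
        fun n : ℕ => ((1 / (n : ℝ) * shannonEntropy (ν 0) (join g (R l) n) : ℝ) : EReal)) atTop) :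
    prodEntropy f μ g ν = metricEntropy f μ + metricEntropy g ν := by
  have hμν := hμ.prodMaps hν hf hg
  have := hμ.1
  have := hν.1
  have hE : ∀ l, entropyAt (X := fun n => X n × Y n) (prodMaps f g)
      (fun n => (μ n).prod (ν n)) (prodSeq (P l) (R l)) = limsup ((fun n : ℕ =>
          ((1 / (n : ℝ) * shannonEntropy (μ 0) (join f (P l) n) : ℝ) : EReal)) +
        fun n : ℕ => ((1 / (n : ℝ) * shannonEntropy (ν 0) (join g (R l) n) : ℝ) : EReal))
        atTop := by
    intro l
    rw [entropyAt]
    congr 1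
    funext n
    rw [shannonEntropy_join_prodSeq hμ hν hf hg, mul_add, EReal.coe_add]
    rfl
  have hd : Tendsto (fun l => seqDiam (X := fun n => X n × Y n) (prodSeq (P l) (R l)))
      atTop (𝓝 0) := by
    refine tendsto_of_tendsto_of_tendsto_of_le_of_le tendsto_const_nhds ?_ (fun _ => zero_le)
      fun l => seqDiam_prodSeq_le (P l) (R l)
    simpa using hPd.max hRd
  have hfg : ∀ n, Measurable (prodMaps f g n) := fun n => (hf n).prodMap (hg n)
  apply le_antisymm
  -- The upper bound uses only subadditivity of `limsup`, not `hadd`.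
  · refine iSup₂_le fun r Q => iSup_le fun hQ => le_of_forall_le_add_coe fun e he => ?_
    obtain ⟨δ, hδ, h⟩ := hQ.exists_entropyAt_le hμν hfg he
    obtain ⟨l, hl⟩ := (hd.eventually_lt_const hδ).exists
    refine (h _ _ hl).trans (add_le_add_left ?_ _)
    rw [hE]
    refine (EReal.limsup_add_le ?_ ?_).trans (add_le_add (le_metricEntropy f (hP l))
      (le_metricEntropy g (hR l)))
    · exact Or.inl (EReal.bot_lt_zero.trans_le (entropyAt_nonneg hμ (P l))).ne'
    · exact Or.inr (EReal.bot_lt_zero.trans_le (entropyAt_nonneg hν (R l))).ne'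
  · refine EReal.add_le_of_forall_lt fun a ha b hb => ?_
    obtain ⟨l, hla, hlb⟩ := ((eventually_lt_entropyAt hμ hf hPd ha).and
      (eventually_lt_entropyAt hν hg hRd hb)).exists
    refine (add_le_add hla.le hlb.le).trans ((hadd l).trans ?_)
    rw [← hE]
    exact le_metricEntropy (X := fun n => X n × Y n) _ ((hP l).prodSeq (hR l))

end Product

/-! ### Autonomous systems and Kolmogorov–Sinai entropy. -/

section Autonomous

theorem exists_pos_le_dist_of_isCompact {Y ι : Type*} [MetricSpace Y] [Finite ι] {K : ι → Set Y}
    (hK : ∀ i, IsCompact (K i)) (hd : ∀ i j, i ≠ j → Disjoint (K i) (K j)) :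
    ∃ δ > (0 : ℝ), ∀ i j, i ≠ j → ∀ x ∈ K i, ∀ y ∈ K j, δ ≤ dist x y := by
  have h : ∀ i j, ∀ᶠ δ : ℝ in 𝓝[>] 0, i ≠ j → ∀ x ∈ K i, ∀ y ∈ K j, δ ≤ dist x y := by
    intro i j
    by_cases hij : i = j
    · simp [hij]
    obtain ⟨r, hr, hdr⟩ := (hd i j hij).exists_thickenings (hK i) (hK j).isClosed
    filter_upwards [Ioo_mem_nhdsGT hr] with δ hδ _ x hx y hy
    by_contra! hlt
    refine disjoint_left.1 hdr ?_ (Metric.self_subset_thickening hr _ hy)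
    exact Metric.mem_thickening_iff.2 ⟨x, hx, by rw [dist_comm]; exact hlt.trans hδ.2⟩
  obtain ⟨δ, h1, h2⟩ := ((eventually_all.2 fun i => eventually_all.2 (h i)).and
    self_mem_nhdsWithin).exists
  exact ⟨δ, h2, h1⟩

variable {Y : Type*}

theorem iter_const (g : Y → Y) (n : ℕ) : iter (X := fun _ => Y) (fun _ => g) n = g^[n] := by
  induction n with
  | zero => rfl
  | succ n ih => rw [Function.iterate_succ', ← ih]; rfl

variable [MeasurableSpace Y]

theorem join_const (g : Y → Y) {k : ℕ} (Q : MeasPartition (Fin k) Y) (n : ℕ) :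
    join (X := fun _ => Y) (fun _ => g) (k := fun _ => k) (fun _ => Q) n = ksJoin g Q n := by
  funext a
  simp only [join, ksJoin, iter_const]

theorem ksEntropy_eq_iSup_entropyAt (g : Y → Y) (ν : Measure Y) :
    ksEntropy g ν = ⨆ (k : ℕ) (Q : MeasPartition (Fin k) Y),
      entropyAt (X := fun _ => Y) (fun _ => g) (fun _ => ν) (k := fun _ => k) (fun _ => Q) := by
  simp only [ksEntropy, entropyAt, join_const]

/-- The preimage of a partition under a measurable map. -/
def MeasPartition.preimage {X ι : Type*} [MeasurableSpace X] (P : MeasPartition ι Y) {T : X → Y}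
    (hT : Measurable T) : MeasPartition ι X where
  part i := T ⁻¹' P.part i
  measurableSet_part i := hT (P.measurableSet_part i)
  disjoint_part i j hij := (P.disjoint_part i j hij).preimage T
  iUnion_part := by rw [← preimage_iUnion, P.iUnion_part, preimage_univ]

/-- The join of the partitions `g⁻⁰ Q, …, g⁻⁽ⁿ⁻¹⁾ Q`. -/
def ksJoinPartition {g : Y → Y} (hg : Measurable g) {k : ℕ} (Q : MeasPartition (Fin k) Y)
    (n : ℕ) : MeasPartition (Fin n → Fin k) Y where
  part := ksJoin g Q n
  measurableSet_part a := MeasurableSet.iInter fun i => hg.iterate i (Q.measurableSet_part _)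
  disjoint_part a b hab := by
    refine disjoint_left.2 fun x hxa hxb => hab ?_
    ext1 i
    exact Q.eq_of_mem (mem_iInter.1 hxa i) (mem_iInter.1 hxb i)
  iUnion_part := by
    refine eq_univ_of_forall fun x => mem_iUnion.2 ?_
    choose a ha using fun i : Fin n => Q.exists_mem_part (g^[i] x)
    exact ⟨a, mem_iInter.2 ha⟩

/-- An itinerary of length `m + n` is one of length `m` followed by the length-`n` itinerary of the
image under `g^[m]`; invariance removes the shift. -/
theorem subadditive_shannonEntropy_ksJoin {g : Y → Y} {ν : Measure Y} [IsProbabilityMeasure ν]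
    (hg : MeasurePreserving g ν ν) {k : ℕ} (Q : MeasPartition (Fin k) Y) :
    Subadditive fun n => shannonEntropy ν (ksJoin g Q n) := by
  intro m n
  have h := shannonEntropy_inter_le ν (ksJoinPartition hg.measurable Q m)
    ((ksJoinPartition hg.measurable Q n).preimage (hg.iterate m).measurable)
  have h1 : shannonEntropy ν
      ((ksJoinPartition hg.measurable Q n).preimage (hg.iterate m).measurable).part =
      shannonEntropy ν (ksJoin g Q n) := by
    refine Finset.sum_congr rfl fun b _ => ?_
    congr 1
    exact (hg.iterate m).measureReal_preimage
      ((ksJoinPartition hg.measurable Q n).measurableSet_part b).nullMeasurableSet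
  rw [h1] at h
  refine le_trans (le_of_eq ?_) h
  change shannonEntropy ν (ksJoin g Q (m + n)) = _
  rw [← shannonEntropy_comp_equiv ν (ksJoin g Q (m + n)) (Fin.appendEquiv m n)]
  congr 1
  funext x
  ext y
  simp [ksJoin, ksJoinPartition, MeasPartition.preimage, Fin.forall_fin_add, Fin.appendEquiv,
    Function.iterate_add_apply, add_comm m]

/-- Fekete's lemma gives a genuine limit. -/
theorem limsup_le_liminf_ksJoin {g : Y → Y} {ν : Measure Y} [IsProbabilityMeasure ν]
    (hg : MeasurePreserving g ν ν) {k : ℕ} (Q : MeasPartition (Fin k) Y) :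
    limsup (fun n : ℕ => ((1 / (n : ℝ) * shannonEntropy ν (ksJoin g Q n) : ℝ) : EReal)) atTop ≤
      liminf (fun n : ℕ => ((1 / (n : ℝ) * shannonEntropy ν (ksJoin g Q n) : ℝ) : EReal))
        atTop := by
  have hsub := subadditive_shannonEntropy_ksJoin hg Q
  have hbdd : BddBelow (range fun n : ℕ => shannonEntropy ν (ksJoin g Q n) / n) :=
    ⟨0, forall_mem_range.2 fun n => div_nonneg (shannonEntropy_nonneg _ _) n.cast_nonneg⟩
  have h : Tendsto (fun n : ℕ => ((1 / (n : ℝ) * shannonEntropy ν (ksJoin g Q n) : ℝ) : EReal))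
      atTop (𝓝 (hsub.lim : EReal)) := by
    refine (continuous_coe_real_ereal.tendsto _).comp ?_
    simpa only [Function.comp_def, one_div, ← div_eq_inv_mul] using hsub.tendsto_lim hbdd
  rw [h.limsup_eq, h.liminf_eq]

variable [MetricSpace Y]

/-- Inner regularity provides compact cores; being finitely many and disjoint, they have a positive
mutual distance, and using them at every time makes it uniform in `n`. -/
theorem admissible_const [CompactSpace Y] [BorelSpace Y] (ν : Measure Y) [IsFiniteMeasure ν]
    {k : ℕ} (Q : MeasPartition (Fin k) Y) :
    Admissible (X := fun _ => Y) (fun _ => ν) (k := fun _ => k) (fun _ => Q) := by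
  refine ⟨⟨k, fun _ => le_rfl⟩, fun ε hε => ?_⟩
  have h : ∀ i, ∃ K ⊆ Q.part i, IsCompact K ∧ ν.real (Q.part i \ K) ≤ ε := by
    intro i
    obtain ⟨K, hKQ, hK, h⟩ := (Q.measurableSet_part i).exists_isCompact_sdiff_lt (μ := ν)
      (measure_ne_top _ _) (ENNReal.ofReal_pos.2 hε).ne'
    exact ⟨K, hKQ, hK, ENNReal.toReal_le_of_le_ofReal hε.le h.le⟩
  choose K hKQ hK hKε using h
  obtain ⟨δ, hδ, hsep⟩ := exists_pos_le_dist_of_isCompact hK fun i j hij =>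
    (Q.disjoint_part i j hij).mono (hKQ i) (hKQ j)
  exact ⟨δ, hδ, fun _ => K, fun _ i => ⟨hK i, hKQ i⟩, fun _ => ⟨hKε, fun i j hij =>
    hsep i j hij.ne⟩⟩

/-- Allows a time-dependent fine-scale sequence to be replaced by its time-zero partition, repeated
forever. -/
theorem seqDiam_const_le {k : ℕ → ℕ} (R : ∀ n : ℕ, MeasPartition (Fin (k n)) Y) :
    seqDiam (X := fun _ => Y) (k := fun _ => k 0) (fun _ => R 0) ≤
      seqDiam (X := fun _ => Y) R :=
  iSup₂_le fun _ i => le_iSup₂_of_le 0 i le_rfl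

/-- Constant sequences are admissible, which gives `≥`; the fine-scale ones among them approximate
every admissible sequence, which gives `≤`. -/
theorem metricEntropy_const_eq_ksEntropy [CompactSpace Y] [BorelSpace Y] {g : Y → Y}
    {ν : Measure Y} (hg : Measurable g)
    (hν : IsFineScaleIMS (X := fun _ => Y) (fun _ => g) (fun _ => ν)) :
    metricEntropy (X := fun _ => Y) (fun _ => g) (fun _ => ν) = ksEntropy g ν := by
  obtain ⟨hν, m, R, -, hRd⟩ := hν
  have := hν.1 0
  rw [ksEntropy_eq_iSup_entropyAt]
  apply le_antisymm
  · refine iSup₂_le fun r Q => iSup_le fun hQ => le_of_forall_le_add_coe fun e he => ?_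
    obtain ⟨δ, hδ, h⟩ := hQ.exists_entropyAt_le hν (fun _ => hg) he
    obtain ⟨l, hl⟩ := (hRd.eventually_lt_const hδ).exists
    refine (h (fun _ => m l 0) (fun _ => R l 0) ((seqDiam_const_le (R l)).trans_lt hl)).trans ?_
    gcongr
    exact le_iSup₂ (f := fun (k : ℕ) (Q : MeasPartition (Fin k) Y) =>
      entropyAt (X := fun _ => Y) (fun _ => g) (fun _ => ν) (k := fun _ => k) (fun _ => Q))
      (m l 0) (R l 0)
  · exact iSup₂_le fun k Q => le_metricEntropy (X := fun _ => Y) _ (admissible_const ν Q)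

end Autonomous

/-! ### The product formula in the three cases. -/

section ProductFormulas

variable {X Y : ℕ → Type*} [∀ n, MeasurableSpace (X n)] [∀ n, MeasurableSpace (Y n)]
  [∀ n, MetricSpace (X n)] [∀ n, MetricSpace (Y n)]
  {f : ∀ n, X n → X (n + 1)} {μ : ∀ n, Measure (X n)}
  {g : ∀ n, Y n → Y (n + 1)} {ν : ∀ n, Measure (Y n)}

theorem prodEntropy_eq_add_of_right_eq_zero (hμ : IsFineScaleIMS f μ) (hν : IsFineScaleIMS g ν)
    (hf : ∀ n, Measurable (f n)) (hg : ∀ n, Measurable (g n)) (h0 : metricEntropy g ν = 0) :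
    prodEntropy f μ g ν = metricEntropy f μ + metricEntropy g ν := by
  obtain ⟨hμ, k, P, hP, hPd⟩ := hμ
  obtain ⟨hν, m, R, hR, hRd⟩ := hν
  have := hν.1
  refine prodEntropy_eq_add hμ hν hf hg hP hR hPd hRd fun l => ?_
  have h1 : entropyAt g ν (R l) ≤ 0 := h0 ▸ le_metricEntropy g (hR l)
  refine (add_le_add_right h1 _).trans ?_
  rw [add_zero]
  refine limsup_le_limsup (Eventually.of_forall fun n => ?_)
  exact le_add_of_nonneg_right (EReal.coe_nonneg.2
    (mul_nonneg (by positivity) (shannonEntropy_nonneg _ _)))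

theorem prodEntropy_eq_add_of_left_eq_zero (hμ : IsFineScaleIMS f μ) (hν : IsFineScaleIMS g ν)
    (hf : ∀ n, Measurable (f n)) (hg : ∀ n, Measurable (g n)) (h0 : metricEntropy f μ = 0) :
    prodEntropy f μ g ν = metricEntropy f μ + metricEntropy g ν := by
  obtain ⟨hμ, k, P, hP, hPd⟩ := hμ
  obtain ⟨hν, m, R, hR, hRd⟩ := hν
  have := hμ.1
  refine prodEntropy_eq_add hμ hν hf hg hP hR hPd hRd fun l => ?_
  have h1 : entropyAt f μ (P l) ≤ 0 := h0 ▸ le_metricEntropy f (hP l)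
  refine (add_le_add_left h1 _).trans ?_
  rw [zero_add]
  refine limsup_le_limsup (Eventually.of_forall fun n => ?_)
  exact le_add_of_nonneg_left (EReal.coe_nonneg.2
    (mul_nonneg (by positivity) (shannonEntropy_nonneg _ _)))

/-- Both summands are the same sequence, so the times at which it exceeds `max a b` serve both
copies at once. -/
theorem prodEntropy_self (hμ : IsFineScaleIMS f μ) (hf : ∀ n, Measurable (f n)) :
    prodEntropy f μ f μ = metricEntropy f μ + metricEntropy f μ := by
  obtain ⟨hμ, k, P, hP, hPd⟩ := hμ
  refine prodEntropy_eq_add hμ hμ hf hf hP hP hPd hPd fun l => ?_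
  refine EReal.add_le_of_forall_lt fun a ha b hb => ?_
  refine le_limsup_of_frequently_le
    ((frequently_lt_of_lt_limsup (h := max_lt ha hb)).mono fun n hn => ?_)
  exact add_le_add ((le_max_left a b).trans hn.le) ((le_max_right a b).trans hn.le)

variable {Z : Type*} [MeasurableSpace Z] [MetricSpace Z] [CompactSpace Z] [BorelSpace Z]
  {T : Z → Z} {ρ : Measure Z}

theorem IsFineScaleIMS.exists_const
    (hρ : IsFineScaleIMS (X := fun _ => Z) (fun _ => T) (fun _ => ρ)) :
    ∃ (m : ℕ → ℕ) (R : ∀ l, MeasPartition (Fin (m l)) Z),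
      (∀ l, Admissible (X := fun _ => Z) (fun _ => ρ) (k := fun _ => m l) fun _ => R l) ∧
      Tendsto (fun l => seqDiam (X := fun _ => Z) (k := fun _ => m l) fun _ => R l)
        atTop (𝓝 0) := by
  obtain ⟨hρ, m, R, -, hRd⟩ := hρ
  have := hρ.1 0
  exact ⟨fun l => m l 0, fun l => R l 0, fun l => admissible_const ρ (R l 0),
    tendsto_of_tendsto_of_tendsto_of_le_of_le tendsto_const_nhds hRd (fun _ => zero_le)
      fun l => seqDiam_const_le (R l)⟩

/-- With constant partitions on the autonomous factor, its `limsup` is at most its `liminf`, and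
`limsup a + liminf b ≤ limsup (a + b)` applies. -/
theorem prodEntropy_eq_add_of_right_const (hμ : IsFineScaleIMS f μ)
    (hρ : IsFineScaleIMS (X := fun _ => Z) (fun _ => T) (fun _ => ρ))
    (hf : ∀ n, Measurable (f n)) (hT : Measurable T) :
    prodEntropy (Y := fun _ => Z) f μ (fun _ => T) (fun _ => ρ) =
      metricEntropy f μ + metricEntropy (X := fun _ => Z) (fun _ => T) (fun _ => ρ) := by
  obtain ⟨m, R, hR, hRd⟩ := hρ.exists_const
  obtain ⟨hμ, k, P, hP, hPd⟩ := hμ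
  have := hρ.1.1 0
  refine prodEntropy_eq_add hμ hρ.1 hf (fun _ => hT) hP hR hPd hRd fun l => ?_
  simp only [join_const]
  refine le_trans (add_le_add_right ?_ _) EReal.le_limsup_add
  simp only [entropyAt, join_const]
  exact limsup_le_liminf_ksJoin ⟨hT, hρ.1.2 0⟩ (R l)

theorem prodEntropy_eq_add_of_left_const (hμ : IsFineScaleIMS f μ)
    (hρ : IsFineScaleIMS (X := fun _ => Z) (fun _ => T) (fun _ => ρ))
    (hf : ∀ n, Measurable (f n)) (hT : Measurable T) :
    prodEntropy (X := fun _ => Z) (fun _ => T) (fun _ => ρ) f μ =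
      metricEntropy (X := fun _ => Z) (fun _ => T) (fun _ => ρ) + metricEntropy f μ := by
  obtain ⟨m, R, hR, hRd⟩ := hρ.exists_const
  obtain ⟨hμ, k, P, hP, hPd⟩ := hμ
  have := hρ.1.1 0
  refine prodEntropy_eq_add hρ.1 hμ (fun _ => hT) hf hR hP hRd hPd fun l => ?_
  simp only [join_const]
  rw [add_comm, add_comm (fun n : ℕ => (_ : EReal))]
  refine le_trans (add_le_add_right ?_ _) EReal.le_limsup_add
  simp only [entropyAt, join_const]
  exact limsup_le_liminf_ksJoin ⟨hT, hρ.1.2 0⟩ (R l)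

end ProductFormulas

end NDS

theorem proposition3p13
    {X : ℕ → Type u} [∀ n, MetricSpace (X n)] [∀ n, CompactSpace (X n)]
    [∀ n, MeasurableSpace (X n)] [∀ n, BorelSpace (X n)]
    (f : ∀ n, X n → X (n + 1)) (μ : ∀ n, Measure (X n))
    (hf : NDS.IsTopologicalNDS f) (hμ : NDS.IsFineScaleIMS f μ) :
    -- (a) one of the two factors has zero entropy
    (∀ {Y : ℕ → Type v} [∀ n, MetricSpace (Y n)] [∀ n, CompactSpace (Y n)]
      [∀ n, MeasurableSpace (Y n)] [∀ n, BorelSpace (Y n)]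
      (g : ∀ n, Y n → Y (n + 1)) (ν : ∀ n, Measure (Y n)),
      NDS.IsTopologicalNDS g → NDS.IsFineScaleIMS g ν →
      (NDS.metricEntropy g ν = 0 →
        NDS.prodEntropy f μ g ν = NDS.metricEntropy f μ + NDS.metricEntropy g ν ∧
        NDS.prodEntropy f μ g ν = NDS.metricEntropy f μ) ∧
      (NDS.metricEntropy f μ = 0 →
        NDS.prodEntropy f μ g ν = NDS.metricEntropy f μ + NDS.metricEntropy g ν ∧
        NDS.prodEntropy f μ g ν = NDS.metricEntropy g ν)) ∧
    -- (b) one of the two factors is autonomous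
    (∀ {Y : Type v} [MetricSpace Y] [CompactSpace Y] [MeasurableSpace Y] [BorelSpace Y]
      (g : Y → Y) (ν : Measure Y),
      NDS.IsTopologicalNDS (X := fun _ => Y) (fun _ => g) →
      NDS.IsFineScaleIMS (X := fun _ => Y) (fun _ => g) (fun _ => ν) →
      (NDS.prodEntropy (Y := fun _ => Y) f μ (fun _ => g) (fun _ => ν) =
          NDS.metricEntropy f μ + NDS.metricEntropy (X := fun _ => Y) (fun _ => g) (fun _ => ν) ∧
        NDS.prodEntropy (Y := fun _ => Y) f μ (fun _ => g) (fun _ => ν) =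
          NDS.metricEntropy f μ + NDS.ksEntropy g ν) ∧
      (NDS.prodEntropy (X := fun _ => Y) (fun _ => g) (fun _ => ν) f μ =
          NDS.metricEntropy (X := fun _ => Y) (fun _ => g) (fun _ => ν) + NDS.metricEntropy f μ ∧
        NDS.prodEntropy (X := fun _ => Y) (fun _ => g) (fun _ => ν) f μ =
          NDS.ksEntropy g ν + NDS.metricEntropy f μ)) ∧
    -- (c) the system is multiplied by itself
    (NDS.prodEntropy f μ f μ = NDS.metricEntropy f μ + NDS.metricEntropy f μ ∧
      NDS.prodEntropy f μ f μ = 2 * NDS.metricEntropy f μ) := by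
  have hfm := hf.measurable
  refine ⟨fun g ν hg hν => ⟨fun h0 => ?_, fun h0 => ?_⟩, fun g ν hg hν => ?_, ?_⟩
  · have h := NDS.prodEntropy_eq_add_of_right_eq_zero hμ hν hfm hg.measurable h0
    exact ⟨h, by rw [h, h0, add_zero]⟩
  · have h := NDS.prodEntropy_eq_add_of_left_eq_zero hμ hν hfm hg.measurable h0
    exact ⟨h, by rw [h, h0, zero_add]⟩
  · have hgm : Measurable g := hg.measurable 0
    have h1 := NDS.prodEntropy_eq_add_of_right_const hμ hν hfm hgm
    have h2 := NDS.prodEntropy_eq_add_of_left_const hμ hν hfm hgm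
    rw [← NDS.metricEntropy_const_eq_ksEntropy hgm hν]
    exact ⟨⟨h1, h1⟩, h2, h2⟩
  · have h := NDS.prodEntropy_self hμ hfm
    refine ⟨h, h.trans ?_⟩
    rw [← one_add_one_eq_two, EReal.right_distrib_of_nonneg zero_le_one zero_le_one, one_mul]
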